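/- Let $n\ge 1$ and $[n]_0=\{0,1,\dots,n\}$. Let $C_1$ be the nested-set complex of the complete graph on $[n]_0$; its simplices are the families $\{X_1,\dots,X_l\}$, $l\ge 0$, with $[n]_0\supsetneq X_1\supsetneq\dots\supsetneq X_l\supsetneq\emptyset$. Let $\mathcal B_1\subseteq C_1$ consist of all families $$\bigl\{\{i_{k+l},\dots,i_k,\dots,i_1\},\dots,\{i_{k+l},\dots,i_k,i_{k-1}\},\{i_{k+l},\dots,i_k\}\bigr\},$$ where $1\le k\le k+l\le n$ and $i_1,\dots,i_{k+l}\in[n]_0$ are distinct. A set $N\subseteq\mathcal B_1$ is called $1$-nested if the union of every family of at least two mutually incomparable members of $N$ lies in $C_1\setminus\mathcal B_1$; let $C$ be the simplicial complex of $1$-nested sets. The $n$-dimensional simple permutoassociahedron $PA_n$ is a polytope whose poset of nonempty faces is isomorphic to $(C,\supseteq)$. A colouring of the facets of a polytope is proper if any two distinct facets of the same colour have no common vertex, and the chromatic number of the polytope is the least number of colours in a proper colouring of its facets. Let $\delta_n$ be the least $m$ for which there is a function $f\colon\mathcal B_1\to\{1,\dots,m\}$ such that no two distinct $A,B\in\mathcal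 B_1$ with $f(A)=f(B)$ belong to a common $1$-nested set. Then, for every $n\ge1$, $\delta_n$ is the chromatic number of $PA_n$ (of every polytope realising $C$ in the above sense), and $$\delta_n\sim n\ln n\qquad\text{as } n\to\infty .$$ -/

import Mathlib

open Filter Asymptotics

/-! ### Convex polytopes, facets and facet colourings -/

namespace Polytope

variable {E : Type*} [NormedAddCommGroup E] [NormedSpace ℝ E]

/-- A convex polytope: the convex hull of a finite set of points. -/
def IsPolytope (P : Set E) : Prop :=
  ∃ s : Set E, s.Finite ∧ P = convexHull ℝ s

/-- A nonempty face of `P`: the nonempty set of maximisers on `P` of a linear functional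
(the zero functional gives `P` itself). -/
def IsFace (P F : Set E) : Prop :=
  IsExposed ℝ P F ∧ F.Nonempty

/-- A facet of `P`: a maximal proper face. -/
def IsFacet (P F : Set E) : Prop :=
  IsFace P F ∧ F ≠ P ∧ ∀ G : Set E, IsFace P G → F ⊆ G → G = F ∨ G = P

/-- Two facets are separated when they have no vertex (extreme point) of `P` in common. -/
def Separated (P F G : Set E) : Prop :=
  ∀ v ∈ P.extremePoints ℝ, ¬ (v ∈ F ∧ v ∈ G)

/-- A colouring of the facets with `m` colours is proper when any two (distinct) facets of the
same colour are separated. -/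
def IsProperColouring (P : Set E) {m : ℕ} (f : {F : Set E // IsFacet P F} → Fin m) : Prop :=
  ∀ F G, F ≠ G → f F = f G → Separated P F.1 G.1

/-- `m` is the chromatic number of `P`: the least number of colours of a proper colouring of
its facets. -/
def IsChromaticNumber (P : Set E) (m : ℕ) : Prop :=
  IsLeast {k : ℕ | ∃ f : {F : Set E // IsFacet P F} → Fin k, IsProperColouring P f} m

/-- `P` realises the abstract simplicial complex `K` (the empty simplex included): the poset of
nonempty faces of `P` is isomorphic to `K` ordered by reverse inclusion. -/
def Realises {α : Type*} (P : Set E) (K : Set (Finset α)) : Prop :=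
  Nonempty ({F : Set E // IsFace P F} ≃o (↥K)ᵒᵈ)

end Polytope

/-! ### Building sets, nested sets, and the simple permutoassociahedron -/

namespace Permutoassoc

/-- The building set of a graph `G`: the nonempty connected sets of vertices. -/
def graphBuildingSet {V : Type*} (G : SimpleGraph V) : Set (Finset V) :=
  {S | S.Nonempty ∧ (G.induce (S : Set V)).Connected}

/-- The nested-set complex of a building set `B` containing the whole vertex set: the subsets
`N` of `B`, not containing the whole vertex set, such that the union of every antichain of at
least two members of `N` is not in `B`. -/
def nestedSetComplex {V : Type*} [Fintype V] [DecidableEq V] (B : Set (Finset V)) :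
    Set (Finset (Finset V)) :=
  {N | (∀ S ∈ N, S ∈ B) ∧ Finset.univ ∉ N ∧
    ∀ A ⊆ N, 2 ≤ A.card → IsAntichain (· ⊆ ·) (A : Set (Finset V)) → A.sup id ∉ B}

/-- The nested sets with respect to a building set `B` of a simplicial complex `K`: the subsets
`N` of `B` such that the union of every antichain of at least two members of `N` is in
`K \ B`. -/
def nestedSets {V : Type*} [DecidableEq V] (K B : Set (Finset V)) : Set (Finset (Finset V)) :=
  {N | (∀ S ∈ N, S ∈ B) ∧
    ∀ A ⊆ N, 2 ≤ A.card → IsAntichain (· ⊆ ·) (A : Set (Finset V)) → A.sup id ∈ K \ B}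

/-- The nested-set complex `C₁` of the complete graph on `{0, …, n}`, realised by the
`n`-dimensional permutohedron. -/
def C₁ (n : ℕ) : Set (Finset (Finset (Fin (n + 1)))) :=
  nestedSetComplex (graphBuildingSet (⊤ : SimpleGraph (Fin (n + 1))))

/-- The building set `B₁` of `C₁`: all families
`{{i_{k+l}, …, i_k, …, i_1}, …, {i_{k+l}, …, i_k, i_{k-1}}, {i_{k+l}, …, i_k}}`, where
`1 ≤ k ≤ k + l ≤ n` and `i_1, …, i_{k+l}` are distinct elements of `{0, …, n}`. -/
def B₁ (n : ℕ) : Set (Finset (Finset (Fin (n + 1)))) :=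
  {A | ∃ k l : ℕ, 1 ≤ k ∧ k + l ≤ n ∧
    ∃ i : ℕ → Fin (n + 1), Set.InjOn i (Set.Icc 1 (k + l)) ∧
      A = (Finset.Icc 1 k).image (fun j => (Finset.Icc j (k + l)).image i)}

/-- The complex of `1`-nested sets: the nested sets with respect to the building set `B₁`
of `C₁`. -/
def oneNestedComplex (n : ℕ) : Set (Finset (Finset (Finset (Fin (n + 1))))) :=
  nestedSets (C₁ n) (B₁ n)

/-- `P` is an `n`-dimensional simple permutoassociahedron: a polytope that realises the complex
of `1`-nested sets. -/
def IsSimplePermutoassociahedron (n : ℕ) {E : Type*} [NormedAddCommGroup E] [NormedSpace ℝ E]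
    (P : Set E) : Prop :=
  Polytope.IsPolytope P ∧ Polytope.Realises P (oneNestedComplex n)

/-- A function `f : B₁ → {1, …, m}` is proper when no two distinct elements of the same colour
belong to the same `1`-nested set. -/
def IsProper (n : ℕ) {m : ℕ} (f : ↥(B₁ n) → Fin m) : Prop :=
  ∀ A B : ↥(B₁ n), A ≠ B → f A = f B → ¬ ∃ N ∈ oneNestedComplex n, A.1 ∈ N ∧ B.1 ∈ N

/-- The chromatic number `δ n`: the least `m` such that there is a proper function
`f : B₁ → {1, …, m}`. -/
noncomputable def δ (n : ℕ) : ℕ :=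
  sInf {m : ℕ | ∃ f : ↥(B₁ n) → Fin m, IsProper n f}

/-- The minimum defining `δ n` is attained. -/
theorem isLeast_δ (n : ℕ) : IsLeast {m : ℕ | ∃ f : ↥(B₁ n) → Fin m, IsProper n f} (δ n) := by
  have hne : {m : ℕ | ∃ f : ↥(B₁ n) → Fin m, IsProper n f}.Nonempty := by
    obtain ⟨m, ⟨e⟩⟩ := Finite.exists_equiv_fin ↥(B₁ n)
    exact ⟨m, e, fun A B hAB h => absurd (e.injective h) hAB⟩
  exact ⟨Nat.sInf_mem hne, fun _ hm => Nat.sInf_le hm⟩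

end Permutoassoc

/-! Every element of `B₁ n` is a chain of sets whose cardinalities fill an interval in `[1, n]`. Two
distinct ones lie in a common nested set iff they are comparable or their union is a chain whose
cardinalities do not form an interval (`mem_C₁_iff`, `mem_B₁_iff`, `exists_mem_nestedSets_iff`).

Upper bound (`δ_le`): colour a chain by its length `ℓ` and by the block of `ℓ + 1` consecutive
integers containing its least cardinality `a`. Intervals of equal length and block overlap or abut,
so their union is an interval. About `n / (ℓ + 1)` colours are spent on each `ℓ`.

Lower bound (`le_δ`): inside one complete flag the elements of `B₁ n` are the subintervals of `[1,
n]`, and those of one colour are pairwise non-nested with no gap. Such a family has at most `ℓ + 1`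
members if one of them has length `ℓ` (`card_le_of_touching`), so with weights `1 / (ℓ + 1)` each
colour class weighs at most 1, and the total weight bounds `δ n` below.

Both bounds are `n` times a harmonic number up to `O(n)`. On the polytope side, facets correspond to
singleton simplices and sharing a vertex to lying in a common simplex, so the two colouring problems
agree. -/

namespace Polytope

/-! ### Facets and common vertices of a polytope realising a complex -/

variable {E : Type*} [NormedAddCommGroup E] [NormedSpace ℝ E]

theorem IsPolytope.isCompact {P : Set E} (hP : IsPolytope P) : IsCompact P := by
  obtain ⟨s, hs, rfl⟩ := hP
  exact hs.isCompact_convexHull ℝ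

/-- Two faces of a polytope have a common vertex iff they contain a common face. -/
theorem not_separated_iff {P F G : Set E} (hP : IsPolytope P) (hF : IsFace P F)
    (hG : IsFace P G) : ¬ Separated P F G ↔ ∃ H, IsFace P H ∧ H ⊆ F ∧ H ⊆ G := by
  constructor
  · intro h
    simp only [Separated, not_forall, not_not] at h
    obtain ⟨v, -, hvF, hvG⟩ := h
    exact ⟨F ∩ G, ⟨hF.1.inter hG.1, v, hvF, hvG⟩, Set.inter_subset_left, Set.inter_subset_right⟩
  · rintro ⟨H, hH, hHF, hHG⟩ h
    obtain ⟨v, hv⟩ := (hH.1.isCompact hP.isCompact).extremePoints_nonempty hH.2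
    exact h v (hH.1.isExtreme.extremePoints_subset_extremePoints hv)
      ⟨hHF hv.1, hHG hv.1⟩

theorem isFace_self {P : Set E} (h : P.Nonempty) : IsFace P P := ⟨IsExposed.refl P, h⟩

/-- If a polytope realises a simplicial complex with vertex set `B`, then its facets correspond to
the elements of `B` in such a way that two facets have a common vertex iff the corresponding
elements belong to a common simplex. -/
theorem exists_facet_equiv {α : Type*} {P : Set E} (hP : IsPolytope P)
    {K : Set (Finset α)} {B : Set α} (hempty : ∅ ∈ K) (hsingle : ∀ a, a ∈ B ↔ {a} ∈ K)
    (hmem : ∀ N ∈ K, ∀ a ∈ N, a ∈ B) (hK : Realises P K) :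
    ∃ e : {F : Set E // IsFacet P F} ≃ ↥B, ∀ F G,
      ¬ Separated P F.1 G.1 ↔ ∃ N ∈ K, (e F).1 ∈ N ∧ (e G).1 ∈ N := by
  classical
  obtain ⟨φ⟩ := hK
  have hne : P.Nonempty := by
    have F := φ.symm (OrderDual.toDual ⟨∅, hempty⟩)
    exact F.2.2.mono F.2.1.subset
  let top : {F : Set E // IsFace P F} := ⟨P, isFace_self hne⟩
  -- The simplex of a face.
  let s : {F : Set E // IsFace P F} → Finset α := fun F => (OrderDual.ofDual (φ F)).1
  have hsK : ∀ F, s F ∈ K := fun F => (OrderDual.ofDual (φ F)).2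
  have hs_le : ∀ F G, s F ⊆ s G ↔ G.1 ⊆ F.1 := fun F G => φ.le_iff_le (x := G) (y := F)
  have hs_surj : ∀ N ∈ K, ∃ F, s F = N := fun N hN =>
    ⟨φ.symm (OrderDual.toDual ⟨N, hN⟩), by simp [s]⟩
  have hs_inj : Function.Injective s := fun F G h =>
    φ.injective (OrderDual.ofDual.injective (Subtype.ext h))
  -- The largest face `P` must correspond to the smallest simplex.
  have htop : s top = ∅ := by
    obtain ⟨F, hF⟩ := hs_surj ∅ hempty
    have : s top ⊆ s F := (hs_le _ _).2 F.2.1.subset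
    rw [hF] at this
    exact Finset.subset_empty.1 this
  have hfacet : ∀ F : {F : Set E // IsFace P F}, IsFacet P F.1 ↔ ∃ a ∈ B, s F = {a} := by
    intro F
    constructor
    · rintro ⟨-, hFP, hmax⟩
      have hn : (s F).Nonempty := by
        rw [Finset.nonempty_iff_ne_empty]
        intro h
        exact hFP (congrArg Subtype.val (hs_inj (h.trans htop.symm)))
      obtain ⟨a, ha⟩ := hn
      have haB := hmem _ (hsK F) a ha
      obtain ⟨G, hG⟩ := hs_surj {a} ((hsingle a).1 haB)
      refine ⟨a, haB, ?_⟩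
      have hFG : F.1 ⊆ G.1 := (hs_le G F).1 (by simpa [hG] using ha)
      rcases hmax G.1 G.2 hFG with h | h
      · rw [← hG, Subtype.ext h]
      · have : G = top := Subtype.ext h
        rw [this, htop] at hG
        exact absurd hG.symm (Finset.singleton_ne_empty a)
    · rintro ⟨a, -, ha⟩
      refine ⟨F.2, fun h => ?_, fun G hG hFG => ?_⟩
      · have : F = top := Subtype.ext h
        rw [this, htop] at ha
        exact Finset.singleton_ne_empty a ha.symm
      · have h : s ⟨G, hG⟩ ⊆ {a} := ha ▸ (hs_le ⟨G, hG⟩ F).2 hFG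
        rcases Finset.subset_singleton_iff.1 h with h | h
        · exact Or.inr (congrArg Subtype.val (hs_inj (h.trans htop.symm)))
        · exact Or.inl (congrArg Subtype.val (hs_inj (h.trans ha.symm)))
  have hex : ∀ F : {F : Set E // IsFacet P F}, ∃ a : ↥B, s ⟨F.1, F.2.1⟩ = {a.1} := fun F => by
    obtain ⟨a, ha, h⟩ := (hfacet ⟨F.1, F.2.1⟩).1 F.2
    exact ⟨⟨a, ha⟩, h⟩
  choose g hg using hex
  have hbij : Function.Bijective g := by
    constructor
    · intro F G h
      have := hs_inj ((hg F).trans ((congrArg (fun a : ↥B => ({a.1} : Finset α)) h).trans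
        (hg G).symm))
      exact Subtype.ext (Subtype.mk.inj this)
    · intro a
      obtain ⟨F, hF⟩ := hs_surj {a.1} ((hsingle a.1).1 a.2)
      have hF' := (hfacet F).2 ⟨a.1, a.2, hF⟩
      refine ⟨⟨F.1, hF'⟩, Subtype.ext (Finset.singleton_injective ?_)⟩
      rw [← hg ⟨F.1, hF'⟩]
      exact hF
  refine ⟨Equiv.ofBijective g hbij, fun F G => ?_⟩
  have hsub : ∀ (F : {F : Set E // IsFacet P F}) (H : {H : Set E // IsFace P H}),
      H.1 ⊆ F.1 ↔ (g F).1 ∈ s H := fun F H => by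
    rw [← Finset.singleton_subset_iff, ← hg F, hs_le]
  rw [not_separated_iff hP F.2.1 G.2.1]
  constructor
  · rintro ⟨H, hH, hF, hG⟩
    exact ⟨s ⟨H, hH⟩, hsK _, (hsub F ⟨H, hH⟩).1 hF, (hsub G ⟨H, hH⟩).1 hG⟩
  · rintro ⟨N, hN, hF, hG⟩
    obtain ⟨H, rfl⟩ := hs_surj N hN
    exact ⟨H.1, H.2, (hsub F H).2 hF, (hsub G H).2 hG⟩

end Polytope

/-! ### Harmonic sums and asymptotics -/

namespace Permutoassoc

theorem isEquivalent_nat_mul_log {u : ℕ → ℝ}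
    (h : ∀ n : ℕ, 1 ≤ n → |u n - n * Real.log n| ≤ 5 * n) :
    IsEquivalent atTop u (fun n : ℕ => (n : ℝ) * Real.log n) := by
  have h1 : (fun n : ℕ => u n - n * Real.log n) =O[atTop] (fun n : ℕ => (n : ℝ) * 1) := by
    refine IsBigO.of_bound 5 ?_
    filter_upwards [eventually_ge_atTop 1] with n hn
    simpa [Real.norm_eq_abs] using h n hn
  have h2 : (fun n : ℕ => (n : ℝ) * 1) =o[atTop] (fun n : ℕ => (n : ℝ) * Real.log n) := by
    refine (isBigO_refl _ _).mul_isLittleO ?_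
    rw [isLittleO_const_left]
    right
    exact tendsto_norm_atTop_atTop.comp
      (Real.tendsto_log_atTop.comp tendsto_natCast_atTop_atTop)
  exact h1.trans_isLittleO h2

/-- The total weight of the subintervals of `[1, n]`, an interval with `ℓ` elements having weight
`1 / (ℓ + 1)`. -/
theorem sum_sum_inv_eq (n : ℕ) :
    ∑ b ∈ Finset.Icc 1 n, ∑ a ∈ Finset.Icc 1 b, (1 : ℝ) / ((b - a : ℕ) + 2) =
      (n + 2) * (harmonic (n + 1) : ℝ) - (2 * n + 2) := by
  have inner : ∀ b : ℕ, ∑ a ∈ Finset.Icc 1 b, (1 : ℝ) / ((b - a : ℕ) + 2) =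
      (harmonic (b + 1) : ℝ) - 1 := by
    intro b
    have h1 : ∑ a ∈ Finset.Icc 1 b, (1 : ℝ) / ((b - a : ℕ) + 2) =
        ∑ i ∈ Finset.range b, (1 : ℝ) / ((i : ℝ) + 2) := by
      refine Finset.sum_nbij' (fun a => b - a) (fun i => b - i) ?_ ?_ ?_ ?_ ?_ <;>
        simp only [Finset.mem_Icc, Finset.mem_range] <;> intros <;> first | omega | trivial
    rw [h1]
    clear h1
    induction b with
    | zero => simp
    | succ b ih =>
      rw [Finset.sum_range_succ, ih, harmonic_succ (b + 1)]
      push_cast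
      ring
  simp only [inner]
  induction n with
  | zero => norm_num
  | succ n ih =>
    rw [Finset.sum_Icc_succ_top (by omega), ih, harmonic_succ (n + 1)]
    have : (n : ℝ) + 2 ≠ 0 := by positivity
    have h3 : (n : ℝ) + 1 + 1 ≠ 0 := by positivity
    push_cast
    field_simp
    ring

/-- Since `harmonic (n + 1)` lies between `log n` and `log n + 1 + 1 / n`, and `log n ≤ n - 1`, the
deviation is at most `4 * n` below and `3 * n` above; the constant 5 is not sharp. -/
theorem abs_sub_nat_mul_log_le {n : ℕ} (hn : 1 ≤ n) {x : ℝ}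
    (hl : (n + 2) * (harmonic (n + 1) : ℝ) - (2 * n + 2) ≤ x)
    (hu : x ≤ (n + 2) * ((harmonic (n + 1) : ℝ) - 1)) : |x - n * Real.log n| ≤ 5 * n := by
  have hn' : (1 : ℝ) ≤ n := by exact_mod_cast hn
  have h0 : 0 ≤ Real.log n := Real.log_nonneg hn'
  have h1 : Real.log n ≤ (harmonic (n + 1) : ℝ) :=
    (Real.log_le_log (by positivity) (by push_cast; linarith)).trans
      (log_add_one_le_harmonic (n + 1))
  have h2 : (harmonic (n + 1) : ℝ) - 1 ≤ Real.log n + 1 / n := by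
    have h := harmonic_le_one_add_log (n + 1)
    have h3 : Real.log ((n + 1 : ℕ) : ℝ) ≤ Real.log n + 1 / n := by
      have h4 : ((n + 1 : ℕ) : ℝ) = n * (1 + 1 / n) := by push_cast; field_simp
      rw [h4, Real.log_mul (by positivity) (by positivity)]
      have := Real.log_le_sub_one_of_pos (x := 1 + 1 / (n : ℝ)) (by positivity)
      linarith
    linarith
  have h5 : Real.log n ≤ n - 1 := Real.log_le_sub_one_of_pos (by positivity)
  have h6 : (1 : ℝ) / n ≤ 1 := by rw [div_le_one (by positivity)]; exact hn'
  have h7 : (n : ℝ) * (1 / n) = 1 := by field_simp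
  rw [abs_le]
  constructor
  · nlinarith [mul_le_mul_of_nonneg_left h1 (by positivity : (0 : ℝ) ≤ n + 2)]
  · nlinarith [mul_le_mul_of_nonneg_left h2 (by positivity : (0 : ℝ) ≤ n + 2)]

end Permutoassoc

/-! ### Chains, intervals of cardinalities and nested pairs -/

namespace Permutoassoc

theorem mem_graphBuildingSet_top {V : Type*} {S : Finset V} :
    S ∈ graphBuildingSet (⊤ : SimpleGraph V) ↔ S.Nonempty := by
  refine ⟨fun h => h.1, fun h => ⟨h, ?_⟩⟩
  have : Nonempty ↥(S : Set V) := h.to_subtype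
  rw [SimpleGraph.induce_top]
  exact SimpleGraph.connected_top

/-- In a complete graph every nonempty set is connected, so the union of two incomparable members
would lie in the building set. -/
theorem mem_C₁_iff {n : ℕ} {N : Finset (Finset (Fin (n + 1)))} :
    N ∈ C₁ n ↔ (∀ S ∈ N, S.Nonempty ∧ S ≠ Finset.univ) ∧
      IsChain (· ⊆ ·) (N : Set (Finset (Fin (n + 1)))) := by
  simp only [C₁, nestedSetComplex, Set.mem_ofPred_eq, mem_graphBuildingSet_top]
  constructor
  · rintro ⟨h1, h2, h3⟩
    refine ⟨fun S hS => ⟨h1 S hS, fun h => h2 (h ▸ hS)⟩, fun S hS T hT hST => ?_⟩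
    by_contra! h
    refine h3 {S, T} (by simp_all [Finset.insert_subset_iff]) (Finset.card_pair hST).ge ?_ ?_
    · simp only [Finset.coe_insert, Finset.coe_singleton]
      rw [isAntichain_insert]
      simp_all
    · simpa using (h1 S hS).inl
  · rintro ⟨h1, h2⟩
    refine ⟨fun S hS => (h1 S hS).1, fun h => (h1 _ h).2 rfl, fun A hA hc hanti => ?_⟩
    obtain ⟨S, hS, T, hT, hST⟩ := Finset.one_lt_card.1 hc
    rcases h2 (hA hS) (hA hT) hST with h | h
    · exact absurd h (hanti hS hT hST)
    · exact absurd h (hanti hT hS hST.symm)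

theorem injOn_card_of_isChain {α : Type*} {A : Set (Finset α)} (hA : IsChain (· ⊆ ·) A) :
    Set.InjOn Finset.card A := by
  intro S hS T hT h
  rcases hA.total hS hT with h' | h'
  · exact Finset.eq_of_subset_of_card_le h' h.ge
  · exact (Finset.eq_of_subset_of_card_le h' h.le).symm

/-- A saturated chain of finite sets is a chain of initial segments of an injective sequence. -/
theorem exists_injOn_image_eq {α : Type*} [DecidableEq α] [Nonempty α] (X : ℕ → Finset α)
    (a b : ℕ) (hab : a ≤ b) (hcard : ∀ s ∈ Set.Icc a b, (X s).card = s)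
    (hmono : ∀ s t, a ≤ s → s ≤ t → t ≤ b → X s ⊆ X t) :
    ∃ i : ℕ → α, Set.InjOn i (Set.Icc 1 b) ∧
      ∀ s ∈ Set.Icc a b, X s = (Finset.Icc 1 s).image i := by
  induction b, hab using Nat.le_induction with
  | base =>
    -- The smallest set is enumerated arbitrarily; each later set adds one element, which becomes
    -- the next term.
    obtain ⟨i, hi⟩ := (Finset.Icc 1 a).finite_toSet.exists_bijOn_of_encard_eq
      (t := (X a : Set α)) (by simp only [Set.encard_coe_eq_coe_finsetCard]; simp [hcard a])
    refine ⟨i, by simpa using hi.injOn, fun s hs => ?_⟩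
    obtain rfl : s = a := le_antisymm hs.2 hs.1
    rw [← Finset.coe_inj, Finset.coe_image, hi.image_eq]
  | succ b hab ih =>
    obtain ⟨i, hi, hX⟩ := ih (fun s hs => hcard s ⟨hs.1, hs.2.trans (by omega)⟩)
      (fun s t h1 h2 h3 => hmono s t h1 h2 (by omega))
    have hsub : X b ⊆ X (b + 1) := hmono b (b + 1) hab (by omega) le_rfl
    have hb : (X b).card = b := hcard b ⟨hab, by omega⟩
    have hb1 : (X (b + 1)).card = b + 1 := hcard (b + 1) ⟨by omega, le_rfl⟩
    obtain ⟨x, hx, hins⟩ := Finset.exists_eq_insert_iff.2 ⟨hsub, by omega⟩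
    have himage : ∀ s ≤ b, (Finset.Icc 1 s).image (Function.update i (b + 1) x) =
        (Finset.Icc 1 s).image i := fun s hs =>
      Finset.image_congr fun j hj => Function.update_of_ne (by simp at hj; omega) _ _
    have hlast : X (b + 1) = (Finset.Icc 1 (b + 1)).image (Function.update i (b + 1) x) := by
      rw [← Finset.insert_Icc_right_eq_Icc_add_one (by omega), Finset.image_insert, himage b le_rfl,
        ← hX b ⟨hab, le_rfl⟩, Function.update_self, hins]
    refine ⟨Function.update i (b + 1) x, ?_, fun s hs => ?_⟩
    · rw [← Finset.coe_Icc, ← Finset.card_image_iff, ← hlast, hb1]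
      simp
    · rcases Nat.lt_or_ge b s with h | h
      · obtain rfl : s = b + 1 := le_antisymm hs.2 h
        exact hlast
      · rw [himage s h, hX s ⟨hs.1, h⟩]

/-- The elements of `B₁ n` are the chains of sets with the cardinalities of an interval. -/
theorem mem_B₁_iff {n : ℕ} {A : Finset (Finset (Fin (n + 1)))} :
    A ∈ B₁ n ↔ ∃ a b, 1 ≤ a ∧ a ≤ b ∧ b ≤ n ∧ IsChain (· ⊆ ·) (A : Set (Finset (Fin (n + 1)))) ∧
      A.image Finset.card = Finset.Icc a b := by
  constructor
  · rintro ⟨k, l, hk, hkl, i, hi, rfl⟩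
    refine ⟨l + 1, k + l, by omega, by omega, hkl, ?_, ?_⟩
    · rintro S hS T hT -
      simp only [Finset.coe_image, Set.mem_image, Finset.mem_coe] at hS hT
      obtain ⟨j, -, rfl⟩ := hS
      obtain ⟨j', -, rfl⟩ := hT
      rcases le_total j j' with h | h
      · exact Or.inr (Finset.image_subset_image (Finset.Icc_subset_Icc_left h))
      · exact Or.inl (Finset.image_subset_image (Finset.Icc_subset_Icc_left h))
    · have hcard : ∀ j ∈ Finset.Icc 1 k,
          ((Finset.Icc j (k + l)).image i).card = k + l + 1 - j := by
        intro j hj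
        rw [Finset.mem_Icc] at hj
        rw [Finset.card_image_of_injOn, Nat.card_Icc]
        exact hi.mono (by rw [Finset.coe_Icc]; exact Set.Icc_subset_Icc_left hj.1)
      rw [Finset.image_image]
      ext s
      simp only [Finset.mem_image, Function.comp_apply, Finset.mem_Icc]
      constructor
      · rintro ⟨j, hj, rfl⟩
        rw [hcard j (Finset.mem_Icc.2 hj)]
        omega
      · intro hs
        exact ⟨k + l + 1 - s, by omega, by rw [hcard _ (Finset.mem_Icc.2 (by omega))]; omega⟩
  · rintro ⟨a, b, ha, hab, hbn, hchain, hcard⟩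
    have hex : ∀ s, ∃ S, s ∈ Finset.Icc a b → S ∈ A ∧ S.card = s := fun s => by
      by_cases hs : s ∈ Finset.Icc a b
      · obtain ⟨S, hS⟩ := Finset.mem_image.1 (hcard ▸ hs)
        exact ⟨S, fun _ => hS⟩
      · exact ⟨∅, fun h => absurd h hs⟩
    choose X hX using hex
    obtain ⟨i, hi, hXi⟩ := exists_injOn_image_eq X a b hab
      (fun s hs => (hX s (by simpa using hs)).2) (fun s t h1 h2 h3 => by
        have hs := hX s (Finset.mem_Icc.2 ⟨h1, h2.trans h3⟩)
        have ht := hX t (Finset.mem_Icc.2 ⟨h1.trans h2, h3⟩)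
        rcases hchain.total hs.1 ht.1 with h | h
        · exact h
        · exact (Finset.eq_of_subset_of_card_le h (by omega)).ge)
    have hA : A = (Finset.Icc a b).image X := by
      ext S
      constructor
      · intro hS
        have hs : S.card ∈ Finset.Icc a b := hcard ▸ Finset.mem_image_of_mem _ hS
        exact Finset.mem_image.2 ⟨S.card, hs,
          injOn_card_of_isChain hchain (hX _ hs).1 hS (hX _ hs).2⟩
      · intro hS
        obtain ⟨s, hs, rfl⟩ := Finset.mem_image.1 hS
        exact (hX s hs).1
    have hkl : b - a + 1 + (a - 1) = b := by omega
    -- `B₁` lists its sets as tails of a sequence, whereas `hXi` gives initial segments, hence the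
    -- reversal `j ↦ b + 1 - j`.
    refine ⟨b - a + 1, a - 1, by omega, by omega, fun j => i (b + 1 - j), ?_, ?_⟩
    · rw [hkl]
      intro j hj j' hj' h
      simp only [Set.mem_Icc] at hj hj'
      have := hi (x₁ := b + 1 - j) (x₂ := b + 1 - j') ⟨by omega, by omega⟩ ⟨by omega, by omega⟩ h
      omega
    · have himage : ∀ j ∈ Set.Icc 1 (b - a + 1),
          (Finset.Icc j b).image (fun j => i (b + 1 - j)) = X (b + 1 - j) := by
        rintro j ⟨hj1, hj2⟩
        rw [hXi _ ⟨by omega, by omega⟩]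
        ext x
        simp only [Finset.mem_image, Finset.mem_Icc]
        constructor
        · rintro ⟨t, ht, rfl⟩
          exact ⟨b + 1 - t, by omega, rfl⟩
        · rintro ⟨t, ht, rfl⟩
          exact ⟨b + 1 - t, by omega, congrArg i (by omega)⟩
      rw [hA, hkl]
      ext S
      simp only [Finset.mem_image, Finset.mem_Icc]
      constructor
      · rintro ⟨s, hs, rfl⟩
        exact ⟨b + 1 - s, by omega, by rw [himage _ ⟨by omega, by omega⟩]; congr 1; omega⟩
      · rintro ⟨j, hj, rfl⟩
        exact ⟨b + 1 - j, by omega, (himage j hj).symm⟩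

theorem mem_C₁_of_mem_B₁ {n : ℕ} {A : Finset (Finset (Fin (n + 1)))} (hA : A ∈ B₁ n) :
    A ∈ C₁ n := by
  obtain ⟨a, b, ha, -, hb, hchain, hcard⟩ := mem_B₁_iff.1 hA
  refine mem_C₁_iff.2 ⟨fun S hS => ?_, hchain⟩
  have hs : S.card ∈ Finset.Icc a b := hcard ▸ Finset.mem_image_of_mem _ hS
  rw [Finset.mem_Icc] at hs
  refine ⟨Finset.card_pos.1 (by omega), ?_⟩
  rintro rfl
  rw [Finset.card_univ, Fintype.card_fin] at hs
  omega

section NestedSets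

variable {V : Type*} [DecidableEq V] {K B : Set (Finset V)}

theorem empty_mem_nestedSets : ∅ ∈ nestedSets K B := by
  refine ⟨by simp, fun A hA hc => ?_⟩
  rw [Finset.subset_empty.1 hA] at hc
  simp at hc

theorem singleton_mem_nestedSets {A : Finset V} : {A} ∈ nestedSets K B ↔ A ∈ B := by
  refine ⟨fun h => h.1 A (by simp), fun h => ⟨by simpa, fun N hN hc => ?_⟩⟩
  have := Finset.card_le_card hN
  simp at this
  omega

/-- Two distinct elements of the building set belong to a common nested set iff they are
comparable or their union is a simplex outside the building set. -/
theorem exists_mem_nestedSets_iff {A A' : Finset V} (hA : A ∈ B) (hA' : A' ∈ B) (hne : A ≠ A') :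
    (∃ N ∈ nestedSets K B, A ∈ N ∧ A' ∈ N) ↔ A ⊆ A' ∨ A' ⊆ A ∨ A ∪ A' ∈ K \ B := by
  constructor
  · rintro ⟨N, hN, h, h'⟩
    by_contra! hcon
    obtain ⟨h1, h2, h3⟩ := hcon
    apply h3
    have := hN.2 {A, A'} (by simp [Finset.insert_subset_iff, h, h']) (Finset.card_pair hne).ge (by
      simp only [Finset.coe_insert, Finset.coe_singleton]
      rw [isAntichain_insert]
      simp_all)
    simpa using this
  · intro h
    refine ⟨{A, A'}, ⟨by simp [hA, hA'], fun N hN hc hanti => ?_⟩, by simp, by simp⟩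
    obtain rfl : N = {A, A'} :=
      Finset.eq_of_subset_of_card_le hN ((Finset.card_pair hne).le.trans hc)
    rcases h with h | h | h
    · exact absurd h (hanti (by simp) (by simp) hne)
    · exact absurd h (hanti (by simp) (by simp) hne.symm)
    · simpa using h

end NestedSets

end Permutoassoc

/-! ### Upper bound: colouring by length and block -/

namespace Permutoassoc

/-- Equal cardinality excludes comparability of distinct chains, and the condition on the union
excludes the remaining way to be nested. -/
theorem isProper_of_union_mem {n m : ℕ} {f : ↥(B₁ n) → Fin m}
    (h : ∀ A A' : ↥(B₁ n), f A = f A' → A.1.card = A'.1.card ∧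
      (A.1 ∪ A'.1 ∈ C₁ n → A.1 ∪ A'.1 ∈ B₁ n)) : IsProper n f := by
  intro A A' hne hf
  have hne' : A.1 ≠ A'.1 := fun h => hne (Subtype.ext h)
  rw [oneNestedComplex, exists_mem_nestedSets_iff A.2 A'.2 hne']
  obtain ⟨hc, hu⟩ := h A A' hf
  rintro (h | h | h)
  · exact hne' (Finset.eq_of_subset_of_card_le h hc.ge)
  · exact hne' (Finset.eq_of_subset_of_card_le h hc.le).symm
  · exact h.2 (hu h.1)

theorem card_block_le (n : ℕ) :
    (((Finset.Icc 1 n).sigma fun l => Finset.range ((n + 1 - l) / (l + 1) + 1)).card : ℝ) ≤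
      (n + 2) * ((harmonic (n + 1) : ℝ) - 1) := by
  rw [Finset.card_sigma]
  have h : (harmonic (n + 1) : ℝ) - 1 = ∑ l ∈ Finset.Icc 1 n, ((l : ℝ) + 1)⁻¹ := by
    induction n with
    | zero => simp
    | succ n ih =>
      rw [Finset.sum_Icc_succ_top (by omega), ← ih, harmonic_succ (n + 1)]
      push_cast
      ring
  rw [h, Finset.mul_sum]
  push_cast
  refine Finset.sum_le_sum fun l hl => ?_
  rw [Finset.mem_Icc] at hl
  rw [Finset.card_range, ← div_eq_mul_inv, le_div_iff₀ (by positivity)]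
  have h1 : ((n + 1 - l) / (l + 1) + 1) * (l + 1) ≤ n + 2 := by
    have := Nat.div_mul_le_self (n + 1 - l) (l + 1)
    rw [add_mul]
    omega
  exact_mod_cast h1

theorem δ_le (n : ℕ) : (δ n : ℝ) ≤ (n + 2) * ((harmonic (n + 1) : ℝ) - 1) := by
  refine le_trans ?_ (card_block_le n)
  set T := (Finset.Icc 1 n).sigma fun l => Finset.range ((n + 1 - l) / (l + 1) + 1) with hT
  have hB := fun A : ↥(B₁ n) => mem_B₁_iff.1 A.2
  choose a b ha hab hb hchain hcard using hB
  have hcard' : ∀ A, A.1.card = b A - a A + 1 := fun A => by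
    rw [← Finset.card_image_of_injOn (injOn_card_of_isChain (hchain A)), hcard A, Nat.card_Icc]
    have := hab A
    omega
  -- The colour of `A` is its length and a block of initial cardinalities.
  let g : ↥(B₁ n) → T := fun A =>
    ⟨⟨b A - a A + 1, a A / (b A - a A + 1 + 1)⟩, by
      have h1 := ha A
      have h2 := hab A
      have h3 := hb A
      simp only [hT, Finset.mem_sigma, Finset.mem_Icc, Finset.mem_range, Nat.lt_succ_iff]
      exact ⟨by omega, Nat.div_le_div_right (by omega)⟩⟩
  rw [Nat.cast_le]
  refine (isLeast_δ n).2 ⟨fun A => T.equivFin (g A), isProper_of_union_mem fun A A' h => ?_⟩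
  have h := congrArg Subtype.val (T.equivFin.injective h)
  simp only [g, Sigma.mk.injEq] at h
  obtain ⟨h1, h2⟩ := h
  rw [h1, heq_eq_eq] at h2
  refine ⟨by rw [hcard', hcard', h1], fun hC => mem_B₁_iff.2
    ⟨min (a A) (a A'), max (b A) (b A'), ?_, ?_, ?_, (mem_C₁_iff.1 hC).2, ?_⟩⟩
  · exact le_min (ha A) (ha A')
  · exact (min_le_left _ _).trans ((hab A).trans (le_max_left _ _))
  · exact max_le (hb A) (hb A')
  -- With equal quotients by `ℓ + 1`, the two left ends differ by at most `ℓ`, so the intervals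
  -- leave no gap.
  · have e1 := Nat.div_add_mod (a A) (b A' - a A' + 1 + 1)
    have e2 := Nat.div_add_mod (a A') (b A' - a A' + 1 + 1)
    have l1 := Nat.mod_lt (a A) (Nat.succ_pos (b A' - a A' + 1))
    have l2 := Nat.mod_lt (a A') (Nat.succ_pos (b A' - a A' + 1))
    rw [h2] at e1
    have h3 := hab A
    have h4 := hab A'
    rw [Finset.image_union, hcard, hcard]
    generalize (b A' - a A' + 1 + 1) * (a A' / (b A' - a A' + 1 + 1)) = z at e1 e2
    simp only [Nat.succ_eq_add_one] at l1 l2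
    ext s
    simp only [Finset.mem_union, Finset.mem_Icc]
    omega

/-! ### Lower bound: intervals in the standard flag -/

/-- The initial segment of size `s` of `Fin (n + 1)`. -/
def initialSegment (n s : ℕ) : Finset (Fin (n + 1)) :=
  Finset.univ.filter fun x => x.val < s

theorem card_initialSegment {n s : ℕ} (hs : s ≤ n) : (initialSegment n s).card = s := by
  rw [initialSegment, Fin.card_filter_val_lt]
  omega

theorem isChain_initialSegment (n : ℕ) (s : Set ℕ) : IsChain (· ⊆ ·) (initialSegment n '' s) := by
  have hmono : Monotone (initialSegment n) := fun s t h x => by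
    simp only [initialSegment, Finset.mem_filter, Finset.mem_univ, true_and]
    omega
  rintro _ ⟨s, -, rfl⟩ _ ⟨t, -, rfl⟩ -
  exact (le_total s t).imp (fun h => hmono h) (fun h => hmono h)

theorem image_card_initialSegment {n : ℕ} {s : Finset ℕ} (hs : ∀ j ∈ s, j ≤ n) :
    (s.image (initialSegment n)).image Finset.card = s := by
  rw [Finset.image_image]
  exact (Finset.image_congr fun j hj => card_initialSegment (hs j hj)).trans Finset.image_id

theorem image_initialSegment_mem_B₁ {n a b : ℕ} (ha : 1 ≤ a) (hab : a ≤ b) (hb : b ≤ n) :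
    (Finset.Icc a b).image (initialSegment n) ∈ B₁ n := by
  refine mem_B₁_iff.2 ⟨a, b, ha, hab, hb, ?_, image_card_initialSegment fun j hj => ?_⟩
  · rw [Finset.coe_image]
    exact isChain_initialSegment n _
  · exact (Finset.mem_Icc.1 hj).2.trans hb

/-- Two intervals in the standard flag with the same colour are neither nested nor separated by a
gap. -/
theorem IsProper.touching {n m : ℕ} {f : ↥(B₁ n) → Fin m} (hf : IsProper n f) {a b c d : ℕ}
    (ha : 1 ≤ a) (hab : a ≤ b) (hb : b ≤ n) (hc : 1 ≤ c) (hcd : c ≤ d) (hd : d ≤ n)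
    (hne : (a, b) ≠ (c, d))
    (h : f ⟨_, image_initialSegment_mem_B₁ ha hab hb⟩ =
      f ⟨_, image_initialSegment_mem_B₁ hc hcd hd⟩) :
    ¬ (c ≤ a ∧ b ≤ d) ∧ c ≤ b + 1 := by
  have hne' : (Finset.Icc a b).image (initialSegment n) ≠
      (Finset.Icc c d).image (initialSegment n) := fun heq => by
    have h2 := congrArg (Finset.image Finset.card) heq
    rw [image_card_initialSegment fun j hj => (Finset.mem_Icc.1 hj).2.trans hb,
      image_card_initialSegment fun j hj => (Finset.mem_Icc.1 hj).2.trans hd] at h2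
    have h3 := (Finset.Icc_subset_Icc_iff hab).1 h2.le
    have h4 := (Finset.Icc_subset_Icc_iff hcd).1 h2.ge
    exact hne (Prod.ext (le_antisymm h4.1 h3.1) (le_antisymm h3.2 h4.2))
  have key := hf _ _ (fun heq => hne' (congrArg Subtype.val heq)) h
  rw [oneNestedComplex, exists_mem_nestedSets_iff (image_initialSegment_mem_B₁ ha hab hb)
    (image_initialSegment_mem_B₁ hc hcd hd) hne'] at key
  refine ⟨fun hsub => key (Or.inl (Finset.image_subset_image
    (Finset.Icc_subset_Icc hsub.1 hsub.2))), ?_⟩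
  by_contra! hgap
  refine key (Or.inr (Or.inr ⟨?_, fun hB => ?_⟩))
  · have h1 := mem_C₁_iff.1 (mem_C₁_of_mem_B₁ (image_initialSegment_mem_B₁ ha hab hb))
    have h2 := mem_C₁_iff.1 (mem_C₁_of_mem_B₁ (image_initialSegment_mem_B₁ hc hcd hd))
    refine mem_C₁_iff.2 ⟨fun S hS => (Finset.mem_union.1 hS).elim (h1.1 S) (h2.1 S), ?_⟩
    rw [← Finset.image_union, Finset.coe_image]
    exact isChain_initialSegment n _
  · obtain ⟨x, y, -, -, -, -, hxy⟩ := mem_B₁_iff.1 hB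
    rw [Finset.image_union, image_card_initialSegment fun j hj => (Finset.mem_Icc.1 hj).2.trans hb,
      image_card_initialSegment fun j hj => (Finset.mem_Icc.1 hj).2.trans hd] at hxy
    -- An interval containing `b` and `c` would contain `b + 1`, which lies in the gap.
    simp only [Finset.ext_iff, Finset.mem_union, Finset.mem_Icc] at hxy
    have h1 := (hxy b).1 (by omega)
    have h2 := (hxy c).1 (by omega)
    have h3 := (hxy (b + 1)).2 (by omega)
    omega

/-- A family of intervals, no two of which are nested or separated by a gap, has at most
`ℓ + 1` members if one of them has `ℓ` elements. -/
theorem card_le_of_touching {S : Finset (ℕ × ℕ)} (hS : ∀ p ∈ S, p.1 ≤ p.2)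
    (htouch : ∀ p ∈ S, ∀ q ∈ S, p ≠ q → ¬ (q.1 ≤ p.1 ∧ p.2 ≤ q.2) ∧ q.1 ≤ p.2 + 1)
    {p : ℕ × ℕ} (hp : p ∈ S) : S.card ≤ p.2 - p.1 + 2 := by
  obtain ⟨M, hM, hmax⟩ := S.exists_max_image Prod.fst ⟨p, hp⟩
  have hMle : ∀ q ∈ S, M.1 ≤ q.2 + 1 := fun q hq => by
    by_cases h : q = M
    · have := hS q hq
      rw [← h]
      omega
    · exact (htouch q hq M hM h).2
  -- Intervals to the left of `p` are sent to their shifted right ends, which exceed `M.1`, and the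
  -- other ones to their left ends, which do not.
  have hle := Finset.card_le_card_of_injOn (s := S) (t := Finset.Icc p.1 (p.2 + 1))
    (fun q => if p.1 ≤ q.1 then q.1 else q.2 + 2) ?_ ?_
  · have := hS p hp
    rw [Nat.card_Icc] at hle
    omega
  · intro q hq
    rw [Finset.mem_coe] at hq
    have h1 := hMle q hq
    have h2 := hmax p hp
    by_cases h : q = p
    · have := hS p hp
      simp only [h, Finset.coe_Icc, Set.mem_Icc]
      split_ifs <;> omega
    · have h3 := htouch p hp q hq (Ne.symm h)
      have h4 := htouch q hq p hp h
      simp only [Finset.coe_Icc, Set.mem_Icc]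
      split_ifs <;> omega
  · intro q hq r hr h
    by_contra hne
    rw [Finset.mem_coe] at hq hr
    have h1 := htouch q hq r hr hne
    have h2 := htouch r hr q hq (Ne.symm hne)
    have h3 := hMle q hq
    have h4 := hMle r hr
    have h5 := hmax q hq
    have h6 := hmax r hr
    simp only at h
    split_ifs at h <;> omega

theorem le_δ (n : ℕ) : (n + 2) * (harmonic (n + 1) : ℝ) - (2 * n + 2) ≤ δ n := by
  obtain ⟨f, hf⟩ := (isLeast_δ n).1
  let T : Finset (ℕ × ℕ) := ((Finset.Icc 1 n) ×ˢ (Finset.Icc 1 n)).filter fun p => p.1 ≤ p.2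
  have hT : ∀ p, p ∈ T ↔ 1 ≤ p.1 ∧ p.1 ≤ p.2 ∧ p.2 ≤ n := fun p => by
    simp only [T, Finset.mem_filter, Finset.mem_product, Finset.mem_Icc]
    omega
  clear_value T
  let g : T → Fin (δ n) := fun p => f ⟨_, image_initialSegment_mem_B₁
    ((hT p.1).1 p.2).1 ((hT p.1).1 p.2).2.1 ((hT p.1).1 p.2).2.2⟩
  have hsum : (n + 2) * (harmonic (n + 1) : ℝ) - (2 * n + 2) =
      ∑ p : T, (1 : ℝ) / ((p.1.2 - p.1.1 : ℕ) + 2) := by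
    rw [← sum_sum_inv_eq, Finset.sum_sigma',
      Finset.sum_coe_sort T fun p => (1 : ℝ) / ((p.2 - p.1 : ℕ) + 2)]
    refine Finset.sum_nbij' (fun x => (x.2, x.1)) (fun p => ⟨p.2, p.1⟩) ?_ ?_ ?_ ?_ ?_
    · intro x hx
      simp only [Finset.mem_sigma, Finset.mem_Icc] at hx
      exact (hT _).2 ⟨hx.2.1, hx.2.2, hx.1.2⟩
    · intro p hp
      have := (hT p).1 hp
      simp only [Finset.mem_sigma, Finset.mem_Icc]
      omega
    all_goals intros; rfl
  rw [hsum, ← Finset.sum_fiberwise Finset.univ g]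
  -- It suffices that each colour class has weight at most 1: every member's weight is at most the
  -- reciprocal of the size of the class.
  refine (Finset.sum_le_card_nsmul _ _ 1 fun c _ => ?_).trans (by simp)
  let S : Finset T := Finset.univ.filter fun p => g p = c
  have hSc : ∀ p ∈ S, (S.card : ℝ) ≤ (p.1.2 - p.1.1 : ℕ) + 2 := fun p hp => by
    have h := card_le_of_touching (S := S.map (Function.Embedding.subtype _)) (p := p.1) ?_ ?_ ?_
    · rw [Finset.card_map] at h
      exact_mod_cast h
    · intro q hq
      obtain ⟨q, -, rfl⟩ := Finset.mem_map.1 hq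
      exact ((hT _).1 q.2).2.1
    · intro q hq r hr hne
      obtain ⟨q, hq', rfl⟩ := Finset.mem_map.1 hq
      obtain ⟨r, hr', rfl⟩ := Finset.mem_map.1 hr
      have hq1 := (hT q.1).1 q.2
      have hr1 := (hT r.1).1 r.2
      have hqr : g q = g r := ((Finset.mem_filter.1 hq').2.trans (Finset.mem_filter.1 hr').2.symm)
      exact hf.touching hq1.1 hq1.2.1 hq1.2.2 hr1.1 hr1.2.1 hr1.2.2 hne hqr
    · exact Finset.mem_map.2 ⟨p, hp, rfl⟩
  change ∑ p ∈ S, (1 : ℝ) / ((p.1.2 - p.1.1 : ℕ) + 2) ≤ 1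
  rcases S.eq_empty_or_nonempty with h | h
  · simp [h]
  · have hpos : (0 : ℝ) < S.card := by exact_mod_cast h.card_pos
    calc ∑ p ∈ S, (1 : ℝ) / ((p.1.2 - p.1.1 : ℕ) + 2) ≤ ∑ _p ∈ S, (1 : ℝ) / S.card :=
          Finset.sum_le_sum fun p hp => one_div_le_one_div_of_le hpos (hSc p hp)
      _ = 1 := by
          rw [Finset.sum_const, nsmul_eq_mul]
          field_simp

/-! ### Transfer to facet colourings -/

theorem isChromaticNumber_δ {n : ℕ} {E : Type*} [NormedAddCommGroup E] [NormedSpace ℝ E]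
    {P : Set E} (hP : IsSimplePermutoassociahedron n P) : Polytope.IsChromaticNumber P (δ n) := by
  obtain ⟨e, he⟩ := Polytope.exists_facet_equiv hP.1 (B := B₁ n) (K := oneNestedComplex n)
    empty_mem_nestedSets (fun _ => singleton_mem_nestedSets.symm) (fun N hN => hN.1) hP.2
  have hiff : ∀ (k : ℕ) (f : ↥(B₁ n) → Fin k),
      IsProper n f ↔ Polytope.IsProperColouring P (f ∘ e) := by
    intro k f
    constructor
    · intro hf F G hne h
      have := hf (e F) (e G) (fun h => hne (e.injective h)) h
      rwa [← he, not_not] at this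
    · intro hf A A' hne h
      have := hf (e.symm A) (e.symm A') (fun h => hne (e.symm.injective h)) (by simpa using h)
      rw [← not_not (a := Polytope.Separated _ _ _), he] at this
      simpa using this
  have hset : {k : ℕ | ∃ f : {F : Set E // Polytope.IsFacet P F} → Fin k,
      Polytope.IsProperColouring P f} = {m : ℕ | ∃ f : ↥(B₁ n) → Fin m, IsProper n f} := by
    ext k
    constructor
    · rintro ⟨f, hf⟩
      refine ⟨f ∘ e.symm, (hiff k _).2 ?_⟩
      rwa [Function.comp_assoc, Equiv.symm_comp_self, Function.comp_id]
    · rintro ⟨f, hf⟩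
      exact ⟨f ∘ e, (hiff k f).1 hf⟩
  rw [Polytope.IsChromaticNumber, hset]
  exact isLeast_δ n

end Permutoassoc

theorem mainTheorem8 :
    (∀ n : ℕ, 1 ≤ n → ∀ (d : ℕ) (P : Set (EuclideanSpace ℝ (Fin d))),
      Permutoassoc.IsSimplePermutoassociahedron n P →
        Polytope.IsChromaticNumber P (Permutoassoc.δ n)) ∧
    IsEquivalent atTop (fun n : ℕ => (Permutoassoc.δ n : ℝ))
      (fun n : ℕ => (n : ℝ) * Real.log n) :=
  ⟨fun _ _ _ _ hP => Permutoassoc.isChromaticNumber_δ hP,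
    Permutoassoc.isEquivalent_nat_mul_log fun n hn =>
      Permutoassoc.abs_sub_nat_mul_log_le hn (Permutoassoc.le_δ n) (Permutoassoc.δ_le n)⟩
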